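/- Let $n \ge 20$ and let $C_1, C_2, C_3$ be three cycles with $n$ vertices each. Then there are a simple graph $G$ with $n$ vertices that contains copies of $C_1$, $C_2$, $C_3$ as pairwise edge-disjoint spanning subgraphs (a \emph{packing} of $C_1, C_2, C_3$), and a drawing of $G$ in the plane in which every edge has at most one crossing and which has at most $14$ edge crossings in total. Here a drawing represents the vertices by distinct points and every edge by a Jordan arc that joins its end-vertices and passes through no other vertex, such that edges with a common end-vertex do not cross and any two edges that share an interior point cross properly there; a crossing is a common interior point of two distinct edges. -/

import Mathlib

/-- The plane. Only its topology is used. -/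
abbrev Plane : Type := ℝ × ℝ

/-- Two subsets `A` and `B` of the plane (images of curves) cross properly at the point `p`:
some homeomorphism of an open neighbourhood of `p` onto an open subset of the plane sends `p`
to the origin, `A` to the horizontal axis and `B` to the vertical axis. In particular the two
curves do not merely touch at `p`. -/
def ProperCrossingAt (A B : Set Plane) (p : Plane) : Prop :=
  ∃ φ : OpenPartialHomeomorph Plane Plane, p ∈ φ.source ∧ φ p = (0, 0) ∧
    ∀ q ∈ φ.source, (q ∈ A ↔ (φ q).2 = 0) ∧ (q ∈ B ↔ (φ q).1 = 0)

/-- A (simple) drawing of a graph in the plane: the vertices are distinct points, every edge is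
a Jordan arc joining the points of its two end-vertices and passing through no other vertex,
edges with a common end-vertex have no further common point, and two edges that meet
at an interior point cross properly there. -/
structure PlaneDrawing {V : Type*} (G : SimpleGraph V) where
  /-- the point that represents a vertex -/
  pos : V → Plane
  /-- the (parametrized) curve that represents an edge -/
  arc : G.edgeSet → C(unitInterval, Plane)
  pos_injective : Function.Injective pos
  arc_injective : ∀ e, Function.Injective (arc e)
  arc_ends : ∀ e, s(arc e 0, arc e 1) = Sym2.map pos (e : Sym2 V)
  arc_avoids : ∀ (e : G.edgeSet) (t : unitInterval) (v : V), arc e t = pos v → t = 0 ∨ t = 1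
  adjacent_disjoint : ∀ e f : G.edgeSet, e ≠ f →
    (∃ v : V, v ∈ (e : Sym2 V) ∧ v ∈ (f : Sym2 V)) →
    Disjoint (arc e '' Set.Ioo 0 1) (arc f '' Set.Ioo 0 1)
  proper : ∀ e f : G.edgeSet, e ≠ f →
    ∀ p ∈ (arc e '' Set.Ioo 0 1) ∩ (arc f '' Set.Ioo 0 1),
      ProperCrossingAt (Set.range (arc e)) (Set.range (arc f)) p

namespace PlaneDrawing

variable {V : Type*} {G : SimpleGraph V}

/-- The edge crossings of a drawing: pairs consisting of an unordered pair of distinct edges and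
a common interior point of these two edges. -/
def crossings (D : PlaneDrawing G) : Set (Sym2 G.edgeSet × Plane) :=
  {c | ∃ e f : G.edgeSet, e ≠ f ∧ c.1 = s(e, f) ∧
    c.2 ∈ (D.arc e '' Set.Ioo 0 1) ∩ (D.arc f '' Set.Ioo 0 1)}

/-- A drawing is 1-planar if every edge takes part in at most one crossing. A 1-plane graph is a
graph together with such a drawing. -/
def IsOnePlane (D : PlaneDrawing G) : Prop :=
  ∀ e : G.edgeSet, {c ∈ D.crossings | e ∈ c.1}.encard ≤ 1

end PlaneDrawing

/-- The graph `G` is a packing of the graphs `H i`: it contains copies of all of them as spanning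
subgraphs, and these copies are pairwise edge-disjoint. -/
def IsPacking {ι : Type*} {W : ι → Type*} {V : Type*} (H : ∀ i, SimpleGraph (W i))
    (G : SimpleGraph V) : Prop :=
  ∃ φ : ∀ i, W i ≃ V,
    (∀ i, (H i).map (φ i).toEmbedding ≤ G) ∧
    ∀ i j, i ≠ j →
      Disjoint ((H i).map (φ i).toEmbedding).edgeSet ((H j).map (φ j).toEmbedding).edgeSet

/-!
The graph is a long triangulated tube that is closed at both ends. Label the vertices along a
helix of circumference three and join `i` to `i ± 1`, `i ± 2`, `i ± 3`. Placed on three rays from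
the origin, at distances growing with `i`, this is a straight-line drawing without crossings, as
every edge lies on a ray or in the cone between two rays (`disjoint_midCell`). Colour `0` takes
the edges of length `2`; colours `1` and `2` take the edges of lengths `1` and `3` alternately,
according to the parity of the lower end (`colorStep`). So every vertex has one upward and one
downward edge in each colour.

The tube is closed at both ends by the same piece on nine vertices, in which each colour is a
Hamiltonian path (`endPath`) whose two ends continue into the tube. The pieces contain more edges
than a plane drawing allows: each one has five crossings, with no edge in two of them. The inner
piece is drawn inside the triangle of its three outermost vertices, the outer one is a mirror
image and is drawn outside the corresponding large triangle; the gauge of the triangle keeps the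
two pieces and the tube apart. Inside a piece the incidences are a finite computation with
integers (`separated_endCells`): two segments are disjoint as soon as a linear functional
separates them.

For the Hamiltonian cycles, the vertices below `k` carry a path in each colour whose ends are
among `k - 1`, `k - 2`, `k - 3`, and the vertex `k` is appended at one of them (`exists_path`);
the path of the outer piece finally joins the two ends (`exists_cycle`). The reflection
`i ↦ n - 1 - i` preserves parities for odd `n` and changes them for even `n`; it also turns the
upper end of an edge into the lower one, which for odd length has the other parity. Hence colours
`1` and `2` trade places in the outer piece exactly when `n` is odd.
-/

/-! ### Straight-line drawings -/

/-- The determinant of two plane vectors. -/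
def det₂ (u v : Plane) : ℝ := u.1 * v.2 - u.2 * v.1

lemma det₂_neg_left (u v : Plane) : det₂ (-u) v = -det₂ u v := by
  simp only [det₂, Prod.fst_neg, Prod.snd_neg]; ring

lemma det₂_neg_right (u v : Plane) : det₂ u (-v) = -det₂ u v := by
  simp only [det₂, Prod.fst_neg, Prod.snd_neg]; ring

lemma mem_openSegment_iff_exists {a b p : Plane} :
    p ∈ openSegment ℝ a b ↔ ∃ t ∈ Set.Ioo (0 : ℝ) 1, a + t • (b - a) = p := by
  rw [openSegment_eq_image']; rfl

lemma mem_segment_iff_exists {a b p : Plane} :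
    p ∈ segment ℝ a b ↔ ∃ t ∈ Set.Icc (0 : ℝ) 1, a + t • (b - a) = p := by
  rw [segment_eq_image']; rfl

/-- The affine coordinates with origin `p` and axes along the independent vectors `u`, `v`. -/
noncomputable def frameHomeomorph (p u v : Plane) (h : det₂ u v ≠ 0) : Plane ≃ₜ Plane where
  toFun q := (det₂ (q - p) v / det₂ u v, det₂ u (q - p) / det₂ u v)
  invFun r := p + r.1 • u + r.2 • v
  left_inv q := by
    ext <;> simp <;> field_simp <;> simp [det₂] <;> ring
  right_inv r := by
    ext <;> simp <;> field_simp <;> simp [det₂] <;> ring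
  continuous_toFun := by unfold det₂; fun_prop
  continuous_invFun := by fun_prop

/-- Two segments in different directions cross properly at a common interior point. -/
lemma properCrossingAt_segment {a b c d p : Plane} (h : det₂ (b - a) (d - c) ≠ 0)
    (hp : p ∈ openSegment ℝ a b) (hq : p ∈ openSegment ℝ c d) :
    ProperCrossingAt (segment ℝ a b) (segment ℝ c d) p := by
  obtain ⟨t, ⟨ht0, ht1⟩, rfl⟩ := mem_openSegment_iff_exists.1 hp
  obtain ⟨s, ⟨hs0, hs1⟩, hs⟩ := mem_openSegment_iff_exists.1 hq
  set p := a + t • (b - a) with hpdef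
  set F := frameHomeomorph p (b - a) (d - c) h with hF
  have hinv : ∀ q, q = p + (F q).1 • (b - a) + (F q).2 • (d - c) := fun q =>
    (F.left_inv q).symm
  have hval : ∀ r : Plane, F (p + r.1 • (b - a) + r.2 • (d - c)) = r := fun r => F.right_inv r
  -- On this box around `p` each of the two segments agrees with the line that it spans.
  let S : Set Plane := F ⁻¹' (Set.Ioo (-t) (1 - t) ×ˢ Set.Ioo (-s) (1 - s))
  have hS : IsOpen S := (isOpen_Ioo.prod isOpen_Ioo).preimage F.continuous
  have hFp : F p = (0, 0) := by simpa using hval (0, 0)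
  refine ⟨F.toOpenPartialHomeomorph.restrOpen S hS, ?_, ?_, ?_⟩
  · simp [S, hFp, ht0, ht1, hs0, hs1]
  · simpa using hFp
  · intro q hq
    have hqS : F q ∈ Set.Ioo (-t) (1 - t) ×ˢ Set.Ioo (-s) (1 - s) := by simpa [S] using hq
    obtain ⟨⟨h1, h2⟩, h3, h4⟩ := hqS
    have key : (q ∈ segment ℝ a b ↔ (F q).2 = 0) ∧ (q ∈ segment ℝ c d ↔ (F q).1 = 0) := by
      constructor
      · rw [mem_segment_iff_exists]
        constructor
        · rintro ⟨r, -, hr⟩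
          have : q = p + (r - t, (0 : ℝ)).1 • (b - a) + (r - t, (0 : ℝ)).2 • (d - c) := by
            rw [← hr, hpdef]; module
          rw [this, hval]
        · intro h0
          refine ⟨t + (F q).1, ⟨by linarith, by linarith⟩, ?_⟩
          conv_rhs => rw [hinv q, h0, hpdef]
          module
      · rw [mem_segment_iff_exists]
        constructor
        · rintro ⟨r, -, hr⟩
          have : q = p + ((0 : ℝ), r - s).1 • (b - a) + ((0 : ℝ), r - s).2 • (d - c) := by
            rw [← hr, ← hs]; module
          rw [this, hval]
        · intro h0
          refine ⟨s + (F q).2, ⟨by linarith, by linarith⟩, ?_⟩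
          conv_rhs => rw [hinv q, h0, ← hs]
          module
    simpa using key

/-- Two segments in different directions have at most one common point. -/
lemma eq_of_mem_openSegment {a b c d p q : Plane} (h : det₂ (b - a) (d - c) ≠ 0)
    (hp : p ∈ openSegment ℝ a b) (hp' : p ∈ openSegment ℝ c d)
    (hq : q ∈ openSegment ℝ a b) (hq' : q ∈ openSegment ℝ c d) : p = q := by
  obtain ⟨t, -, rfl⟩ := mem_openSegment_iff_exists.1 hp
  obtain ⟨s, -, hs⟩ := mem_openSegment_iff_exists.1 hp'
  obtain ⟨t', -, rfl⟩ := mem_openSegment_iff_exists.1 hq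
  obtain ⟨s', -, hs'⟩ := mem_openSegment_iff_exists.1 hq'
  have e : (t - t') • (b - a) = (s - s') • (d - c) := by
    linear_combination (norm := module) hs' - hs
  have e' : (t - t') * det₂ (b - a) (d - c) = 0 := by
    have e1 := congrArg Prod.fst e
    have e2 := congrArg Prod.snd e
    simp only [Prod.smul_fst, Prod.smul_snd, smul_eq_mul] at e1 e2
    unfold det₂
    linear_combination (d - c).2 * e1 - (d - c).1 * e2
  have : t = t' := by
    rcases mul_eq_zero.1 e' with h0 | h0
    · linarith
    · exact absurd h0 h
  rw [this]

/-- Two segments in different directions with a common end have disjoint interiors. -/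
lemma disjoint_openSegment_of_left_eq {a b d : Plane} (h : det₂ (b - a) (d - a) ≠ 0) :
    Disjoint (openSegment ℝ a b) (openSegment ℝ a d) := by
  rw [Set.disjoint_left]
  intro p hp hq
  obtain ⟨t, ⟨ht, -⟩, rfl⟩ := mem_openSegment_iff_exists.1 hp
  obtain ⟨s, -, hs⟩ := mem_openSegment_iff_exists.1 hq
  have e : t • (b - a) = s • (d - a) := (add_left_cancel hs).symm
  have e' : t * det₂ (b - a) (d - a) = 0 := by
    have e1 := congrArg Prod.fst e
    have e2 := congrArg Prod.snd e
    simp only [Prod.smul_fst, Prod.smul_snd, smul_eq_mul] at e1 e2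
    unfold det₂
    linear_combination (d - a).2 * e1 - (d - a).1 * e2
  rcases mul_eq_zero.1 e' with h0 | h0
  · exact ht.ne' h0
  · exact h h0

/-- The parametrized segment between two points. -/
noncomputable def segmentArc (a b : Plane) : C(unitInterval, Plane) where
  toFun t := a + (t : ℝ) • (b - a)
  continuous_toFun := by fun_prop

lemma segmentArc_image_Ioo (a b : Plane) :
    segmentArc a b '' Set.Ioo 0 1 = openSegment ℝ a b := by
  ext p
  rw [mem_openSegment_iff_exists]
  constructor
  · rintro ⟨t, ⟨h0, h1⟩, rfl⟩
    exact ⟨t, ⟨h0, h1⟩, rfl⟩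
  · rintro ⟨t, ⟨h0, h1⟩, rfl⟩
    exact ⟨⟨t, h0.le, h1.le⟩, ⟨h0, h1⟩, rfl⟩

lemma segmentArc_range (a b : Plane) : Set.range (segmentArc a b) = segment ℝ a b := by
  ext p
  rw [mem_segment_iff_exists]
  constructor
  · rintro ⟨t, rfl⟩
    exact ⟨t, t.2, rfl⟩
  · rintro ⟨t, ht, rfl⟩
    exact ⟨⟨t, ht⟩, rfl⟩

lemma segmentArc_zero (a b : Plane) : segmentArc a b 0 = a := by simp [segmentArc]

lemma segmentArc_one (a b : Plane) : segmentArc a b 1 = b := by simp [segmentArc]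

lemma segmentArc_injective {a b : Plane} (h : a ≠ b) : Function.Injective (segmentArc a b) := by
  intro s t hst
  have h1 : (s : ℝ) • (b - a) = (t : ℝ) • (b - a) := add_left_cancel hst
  exact Subtype.ext (smul_left_injective ℝ (sub_ne_zero.2 h.symm) h1)

/-- A straight-line drawing of a graph whose vertices have names in `L`. Each possible crossing is
an entry `X k` of a list of pairs of edges (given by names) such that no edge occurs in two
entries; then the drawing is 1-planar, and the length of the list bounds the number of
crossings. -/
theorem exists_planeDrawing_of_segments {V L ι : Type*} [Fintype ι] (G : SimpleGraph V)
    (pos : V → Plane) (name : V ↪ L) (X : ι → Sym2 (Sym2 L)) (hpos : Function.Injective pos)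
    (havoid : ∀ u v w, G.Adj u v → pos w ∉ openSegment ℝ (pos u) (pos v))
    (hcross : ∀ u v u' v', G.Adj u v → G.Adj u' v' → s(u, v) ≠ s(u', v') →
      Disjoint (openSegment ℝ (pos u) (pos v)) (openSegment ℝ (pos u') (pos v')) ∨
        (det₂ (pos v - pos u) (pos v' - pos u') ≠ 0 ∧
          ∃ k, s(s(name u, name v), s(name u', name v')) = X k))
    (hX : ∀ k k' e, e ∈ X k → e ∈ X k' → k = k') :
    ∃ D : PlaneDrawing G, D.IsOnePlane ∧ D.crossings.encard ≤ Fintype.card ι := by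
  classical
  have hout : ∀ e : Sym2 V, s(e.out.1, e.out.2) = e := fun e => Quot.out_eq e
  have hadj : ∀ e : G.edgeSet, G.Adj (e : Sym2 V).out.1 (e : Sym2 V).out.2 := by
    intro e
    rw [← SimpleGraph.mem_edgeSet, hout]
    exact e.2
  let arc : G.edgeSet → C(unitInterval, Plane) := fun e =>
    segmentArc (pos (e : Sym2 V).out.1) (pos (e : Sym2 V).out.2)
  have harc : ∀ e, arc e = segmentArc (pos (e : Sym2 V).out.1) (pos (e : Sym2 V).out.2) :=
    fun _ => rfl
  -- The dichotomy of `hcross`, for edges.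
  have key : ∀ e f : G.edgeSet, e ≠ f →
      Disjoint (arc e '' Set.Ioo 0 1) (arc f '' Set.Ioo 0 1) ∨
        (det₂ (pos (e : Sym2 V).out.2 - pos (e : Sym2 V).out.1)
          (pos (f : Sym2 V).out.2 - pos (f : Sym2 V).out.1) ≠ 0 ∧
          ∃ k, s((e : Sym2 V).map name, (f : Sym2 V).map name) = X k) := by
    intro e f hef
    have := hcross _ _ _ _ (hadj e) (hadj f)
    rw [← Sym2.map_mk, ← Sym2.map_mk, hout, hout] at this
    simp only [harc, segmentArc_image_Ioo]
    exact this (fun h => hef (Subtype.ext h))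
  let D : PlaneDrawing G :=
    { pos := pos
      arc := arc
      pos_injective := hpos
      arc_injective := fun e => segmentArc_injective fun h => (hadj e).ne (hpos h)
      arc_ends := fun e => by
        rw [harc, segmentArc_zero, segmentArc_one, ← Sym2.map_mk, hout]
      arc_avoids := fun e t v h => by
        by_contra! hc
        refine havoid _ _ v (hadj e) ?_
        rw [← segmentArc_image_Ioo, ← h]
        exact ⟨t, ⟨unitInterval.pos_iff_ne_zero.2 hc.1, unitInterval.lt_one_iff_ne_one.2 hc.2⟩, rfl⟩
      adjacent_disjoint := by
        rintro e f hef ⟨v, hve, hvf⟩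
        rcases key e f hef with h | ⟨h, -⟩
        · exact h
        simp only [harc, segmentArc_image_Ioo]
        rw [← hout (e : Sym2 V), Sym2.mem_iff] at hve
        rw [← hout (f : Sym2 V), Sym2.mem_iff] at hvf
        -- Turn both edges so that they start at the common end.
        rcases hve with hve | hve <;> rcases hvf with hvf | hvf
        · rw [← hve, ← hvf] at h ⊢
          exact disjoint_openSegment_of_left_eq h
        · rw [← hve, ← hvf] at h ⊢
          rw [openSegment_symm ℝ (pos (f : Sym2 V).out.1)]
          refine disjoint_openSegment_of_left_eq fun h0 => h ?_
          rw [← neg_sub (pos _) (pos v), det₂_neg_right, neg_eq_zero, h0]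
        · rw [← hve, ← hvf] at h ⊢
          rw [openSegment_symm ℝ (pos (e : Sym2 V).out.1)]
          refine disjoint_openSegment_of_left_eq fun h0 => h ?_
          rw [← neg_sub (pos _) (pos v), det₂_neg_left, neg_eq_zero, h0]
        · rw [← hve, ← hvf] at h ⊢
          rw [openSegment_symm ℝ (pos (e : Sym2 V).out.1),
            openSegment_symm ℝ (pos (f : Sym2 V).out.1)]
          refine disjoint_openSegment_of_left_eq fun h0 => h ?_
          rw [← neg_sub (pos _) (pos v), ← neg_sub (pos (f : Sym2 V).out.1) (pos v),
            det₂_neg_left, det₂_neg_right, neg_neg, h0]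
      proper := by
        rintro e f hef p ⟨hp, hq⟩
        rcases key e f hef with h | ⟨h, -⟩
        · exact absurd hq (Set.disjoint_left.1 h hp)
        simp only [harc, segmentArc_image_Ioo] at hp hq
        simp only [harc, segmentArc_range]
        exact properCrossingAt_segment h hp hq }
  have hfst : ∀ c ∈ D.crossings, ∃ k,
      c.1.map (fun e : G.edgeSet => (e : Sym2 V).map name) = X k := by
    rintro ⟨c, p⟩ ⟨e, f, hef, rfl, hp, hq⟩
    rcases key e f hef with h | ⟨-, h⟩
    · exact absurd hq (Set.disjoint_left.1 h hp)
    · exact h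
  -- A crossing is determined by its pair of edges, as these lie on different lines.
  have hsnd : ∀ c ∈ D.crossings, ∀ c' ∈ D.crossings, c.1 = c'.1 → c = c' := by
    rintro ⟨c, p⟩ ⟨e, f, hef, rfl, hp, hq⟩ ⟨c', p'⟩ ⟨e', f', hef', rfl, hp', hq'⟩ hc
    simp only at hc hp hq hp' hq'
    have hcc : p' ∈ arc e '' Set.Ioo 0 1 ∧ p' ∈ arc f '' Set.Ioo 0 1 := by
      rcases Sym2.eq_iff.1 hc with ⟨rfl, rfl⟩ | ⟨rfl, rfl⟩
      · exact ⟨hp', hq'⟩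
      · exact ⟨hq', hp'⟩
    rcases key e f hef with h | ⟨h, -⟩
    · exact absurd hq (Set.disjoint_left.1 h hp)
    have hpp : p = p' := by
      obtain ⟨h1, h2⟩ := hcc
      have hp1 : p ∈ arc e '' Set.Ioo 0 1 := hp
      have hq1 : p ∈ arc f '' Set.Ioo 0 1 := hq
      simp only [harc, segmentArc_image_Ioo] at hp1 hq1 h1 h2
      exact eq_of_mem_openSegment h hp1 hq1 h1 h2
    exact Prod.ext hc hpp
  have hinj : Function.Injective (Sym2.map fun e : G.edgeSet => (e : Sym2 V).map name) :=
    Sym2.map.injective ((Sym2.map.injective name.injective).comp Subtype.val_injective)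
  refine ⟨D, ?_, ?_⟩
  · intro e
    rw [Set.encard_le_one_iff]
    rintro c c' ⟨hc, he⟩ ⟨hc', he'⟩
    obtain ⟨k, hk⟩ := hfst c hc
    obtain ⟨k', hk'⟩ := hfst c' hc'
    have hkk : k = k' := hX k k' ((e : Sym2 V).map name) (hk ▸ Sym2.mem_map.2 ⟨e, he, rfl⟩)
      (hk' ▸ Sym2.mem_map.2 ⟨e, he', rfl⟩)
    exact hsnd c hc c' hc' (hinj (by rw [hk, hk', hkk]))
  · rcases isEmpty_or_nonempty ι with hι | hι
    · have hempty : D.crossings = ∅ :=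
        Set.eq_empty_of_forall_notMem fun c hc => hι.elim (hfst c hc).choose
      simp [hempty]
    choose! κ hκ using hfst
    have hκinj : Set.InjOn κ D.crossings := fun c hc c' hc' h =>
      hsnd c hc c' hc' (hinj (by rw [hκ c hc, hκ c' hc', h]))
    calc D.crossings.encard = (κ '' D.crossings).encard := hκinj.encard_image.symm
      _ ≤ (Set.univ : Set ι).encard := Set.encard_le_encard (Set.subset_univ _)
      _ = Fintype.card ι := by rw [Set.encard_univ, ENat.card_eq_coe_fintype_card]

/-! ### The end pieces -/

/-- The nine vertices of an end piece, in the order in which colour `c` visits them. -/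
def endPath : Fin 3 → List (Fin 9) :=
  ![[8, 6, 0, 1, 2, 3, 4, 5, 7], [8, 2, 6, 1, 3, 5, 0, 4, 7], [8, 5, 2, 0, 3, 7, 1, 4, 6]]

/-- The edges of colour `c` in an end piece. -/
def endEdges (c : Fin 3) : List (Fin 9 × Fin 9) := (endPath c).zip (endPath c).tail

/-- The edges of an end piece together with the degenerate edges `(a, a)`, which stand for its
vertices. -/
def endCells : List (Fin 9 × Fin 9) :=
  (List.finRange 9).map (fun a => (a, a)) ++ (List.finRange 3).flatMap endEdges

/-- The five crossings in an end piece. -/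
def endCrossing : Fin 5 → Sym2 (Sym2 (Fin 9)) :=
  ![s(s(4, 6), s(1, 7)), s(s(0, 4), s(1, 3)), s(s(0, 5), s(2, 3)), s(s(1, 2), s(0, 6)),
    s(s(4, 5), s(3, 7))]

/-- Positions of the vertices of the inner (`false`) and of the outer (`true`) end piece. The
vertices `6`, `7`, `8` are the corners of the triangle `gauge = 3`; the other vertices lie inside
this triangle for the inner piece, and outside for the outer one. Only the inequalities checked in
`separated_endCells`, `endPos_inner_le` and `le_endPos_outer` matter. -/
def endPos : Bool → Fin 9 → ℤ × ℤ
  | false => ![(-1, -1), (2, 0), (-2, -2), (-1, 0), (0, 2), (-2, -1), (3, 0), (0, 3), (-3, -3)]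
  | true => ![(-4, -2), (-3, -2), (-6, -6), (-2, 4), (-1, 2), (-2, 6), (-3, -3), (0, 3), (3, 0)]

/-- The value of the linear functional `l` at `a`. -/
def dotInt (l a : ℤ × ℤ) : ℤ := l.1 * a.1 + l.2 * a.2

/-- The linear functional `l` weakly separates the segment `ab` from the segment `pq`, and is not
constant on the four points. -/
def SepBy (l a b p q : ℤ × ℤ) : Prop :=
  dotInt l a ≤ dotInt l p ∧ dotInt l a ≤ dotInt l q ∧ dotInt l b ≤ dotInt l p ∧
    dotInt l b ≤ dotInt l q ∧
    (dotInt l a < dotInt l p ∨ dotInt l a < dotInt l q ∨ dotInt l b < dotInt l p ∨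
      dotInt l b < dotInt l q)

instance (l a b p q : ℤ × ℤ) : Decidable (SepBy l a b p q) := by
  unfold SepBy; infer_instance

/-- Some functional parallel or perpendicular to one of the segments `ab`, `pq`, `ap` separates
`ab` from `pq`. -/
def Separated (a b p q : ℤ × ℤ) : Prop :=
  ∃ l ∈ [b - a, q - p, p - a, ((b - a).2, -(b - a).1), ((q - p).2, -(q - p).1)],
    SepBy l a b p q ∨ SepBy (-l) a b p q

instance (a b p q : ℤ × ℤ) : Decidable (Separated a b p q) := by
  unfold Separated; infer_instance

lemma separated_endCells : ∀ o, ∀ e ∈ endCells, ∀ f ∈ endCells, e ≠ f →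
    Separated (endPos o e.1) (endPos o e.2) (endPos o f.1) (endPos o f.2) ∨
      ((endPos o e.2 - endPos o e.1).1 * (endPos o f.2 - endPos o f.1).2 -
          (endPos o e.2 - endPos o e.1).2 * (endPos o f.2 - endPos o f.1).1 ≠ 0 ∧
        ∃ k, s(s(e.1, e.2), s(f.1, f.2)) = endCrossing k) := by
  decide +kernel

lemma endCrossing_eq_of_mem : ∀ k k' : Fin 5, ∀ a b : Fin 9,
    s(a, b) ∈ endCrossing k → s(a, b) ∈ endCrossing k' → k = k' := by
  decide +kernel

lemma endPos_inner_le : ∀ a, (endPos false a).1 + (endPos false a).2 ≤ 3 ∧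
    (endPos false a).2 - 2 * (endPos false a).1 ≤ 3 ∧
    (endPos false a).1 - 2 * (endPos false a).2 ≤ 3 := by
  decide +kernel

lemma le_endPos_outer : ∀ e ∈ endCells,
    (3 ≤ (endPos true e.1).1 + (endPos true e.1).2 ∧
      3 ≤ (endPos true e.2).1 + (endPos true e.2).2) ∨
    (3 ≤ (endPos true e.1).2 - 2 * (endPos true e.1).1 ∧
      3 ≤ (endPos true e.2).2 - 2 * (endPos true e.2).1) ∨
    (3 ≤ (endPos true e.1).1 - 2 * (endPos true e.1).2 ∧
      3 ≤ (endPos true e.2).1 - 2 * (endPos true e.2).2) := by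
  decide +kernel

lemma endEdges_color_unique : ∀ c c' : Fin 3, ∀ e ∈ endEdges c, ∀ f ∈ endEdges c',
    s(e.1, e.2) = s(f.1, f.2) → c = c' := by
  decide +kernel

lemma endEdges_subset_endCells {c : Fin 3} {e : Fin 9 × Fin 9} (h : e ∈ endEdges c) :
    e ∈ endCells :=
  List.mem_append_right _ (List.mem_flatMap.2 ⟨c, List.mem_finRange c, h⟩)

lemma diag_mem_endCells (a : Fin 9) : (a, a) ∈ endCells :=
  List.mem_append_left _ (List.mem_map.2 ⟨a, List.mem_finRange a, rfl⟩)

/-! ### Rays and the gauge of the triangle -/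

/-- The three directions in which the vertices are placed, indexed periodically. -/
def ray (i : ℕ) : Plane :=
  if i % 3 = 0 then (1, 0) else if i % 3 = 1 then (0, 1) else (-1, -1)

lemma ray_congr {i j : ℕ} (h : i % 3 = j % 3) : ray i = ray j := by
  simp only [ray, h]

/-- The gauge of the triangle with corners `ray 0`, `ray 1`, `ray 2`. -/
def gauge₃ (p : Plane) : ℝ := max (p.1 + p.2) (max (p.2 - 2 * p.1) (p.1 - 2 * p.2))

/-- The linear map that sends the standard basis to `c • ray k`, `c • ray (k + 1)`. It permutes
the rays and multiplies the gauge by `c`. -/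
def frame (c : ℝ) (k : ℕ) (r : Plane) : Plane := c • (r.1 • ray k + r.2 • ray (k + 1))

lemma mod_three_cases (k : ℕ) : (k % 3 = 0 ∧ (k + 1) % 3 = 1) ∨ (k % 3 = 1 ∧ (k + 1) % 3 = 2) ∨
    (k % 3 = 2 ∧ (k + 1) % 3 = 0) := by omega

lemma gauge₃_frame {c : ℝ} (hc : 0 ≤ c) (k : ℕ) (r : Plane) :
    gauge₃ (frame c k r) = c * gauge₃ r := by
  simp only [gauge₃, mul_max_of_nonneg _ _ hc]
  -- The three functionals in the definition of the gauge are permuted cyclically.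
  rcases mod_three_cases k with ⟨h, h'⟩ | ⟨h, h'⟩ | ⟨h, h'⟩
  · congr 1
    · simp [frame, ray, h, h']; ring
    · congr 1 <;> simp [frame, ray, h, h'] <;> ring
  · rw [← max_assoc (c * _), max_comm _ (c * (r.1 - 2 * r.2))]
    congr 1
    · simp [frame, ray, h, h']; ring
    · congr 1 <;> simp [frame, ray, h, h'] <;> ring
  · rw [max_comm (c * (r.1 + r.2)), max_assoc]
    congr 1
    · simp [frame, ray, h, h']; ring
    · congr 1 <;> simp [frame, ray, h, h'] <;> ring

lemma gauge₃_cone {x y : ℝ} (hx : 0 ≤ x) (hy : 0 ≤ y) (k : ℕ) :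
    gauge₃ (x • ray k + y • ray (k + 1)) = x + y := by
  have h := gauge₃_frame zero_le_one k (x, y)
  simp only [frame, one_smul, one_mul] at h
  rw [h, gauge₃, max_eq_left]
  exact max_le (by simp only; linarith) (by simp only; linarith)

/-- Every nonzero point lies in exactly one of the half-open cones between consecutive rays. -/
lemma cone_unique {x y x' y' : ℝ} {k k' : ℕ} (hx : 0 < x) (hy : 0 ≤ y) (hx' : 0 < x')
    (hy' : 0 ≤ y') (h : x • ray k + y • ray (k + 1) = x' • ray k' + y' • ray (k' + 1)) :
    k % 3 = k' % 3 ∧ x = x' ∧ y = y' := by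
  have h1 := congrArg Prod.fst h
  have h2 := congrArg Prod.snd h
  rcases mod_three_cases k with ⟨e, f⟩ | ⟨e, f⟩ | ⟨e, f⟩ <;>
  rcases mod_three_cases k' with ⟨e', f'⟩ | ⟨e', f'⟩ | ⟨e', f'⟩ <;>
    simp [ray, e, f, e', f'] at h1 h2 ⊢ <;>
    first
    | exact ⟨by linarith, by linarith⟩
    | linarith

lemma det₂_frame (c : ℝ) (k : ℕ) (u v : Plane) :
    det₂ (frame c k u) (frame c k v) = c ^ 2 * det₂ u v := by
  rcases mod_three_cases k with ⟨h, h'⟩ | ⟨h, h'⟩ | ⟨h, h'⟩ <;>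
    simp [frame, ray, h, h', det₂] <;> ring

lemma frame_sub (c : ℝ) (k : ℕ) (u v : Plane) :
    frame c k u - frame c k v = frame c k (u - v) := by
  simp only [frame, Prod.fst_sub, Prod.snd_sub]; module

lemma mem_openSegment_frame {c : ℝ} {k : ℕ} {u v p : Plane}
    (h : p ∈ openSegment ℝ (frame c k u) (frame c k v)) :
    ∃ r ∈ openSegment ℝ u v, p = frame c k r := by
  obtain ⟨t, ht, rfl⟩ := mem_openSegment_iff_exists.1 h
  refine ⟨u + t • (v - u), mem_openSegment_iff_exists.2 ⟨t, ht, rfl⟩, ?_⟩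
  simp only [frame, Prod.fst_add, Prod.snd_add, Prod.smul_fst, Prod.smul_snd, Prod.fst_sub,
    Prod.snd_sub, smul_eq_mul]
  module

lemma frame_injective {c : ℝ} (hc : 0 < c) (k : ℕ) : Function.Injective (frame c k) := by
  intro u v h
  have h1 := congrArg Prod.fst h
  have h2 := congrArg Prod.snd h
  rcases mod_three_cases k with ⟨e, f⟩ | ⟨e, f⟩ | ⟨e, f⟩ <;>
    simp [frame, ray, e, f, hc.ne'] at h1 h2 <;> ext <;> linarith

/-- A linear functional that weakly separates the ends of two segments, and is not constant on
them, separates their interiors. -/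
lemma disjoint_openSegment_of_functional (α β : ℝ) {a b p q : Plane}
    (h1 : α * a.1 + β * a.2 ≤ α * p.1 + β * p.2) (h2 : α * a.1 + β * a.2 ≤ α * q.1 + β * q.2)
    (h3 : α * b.1 + β * b.2 ≤ α * p.1 + β * p.2) (h4 : α * b.1 + β * b.2 ≤ α * q.1 + β * q.2)
    (h : α * a.1 + β * a.2 < α * p.1 + β * p.2 ∨ α * a.1 + β * a.2 < α * q.1 + β * q.2 ∨
      α * b.1 + β * b.2 < α * p.1 + β * p.2 ∨ α * b.1 + β * b.2 < α * q.1 + β * q.2) :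
    Disjoint (openSegment ℝ a b) (openSegment ℝ p q) := by
  rw [Set.disjoint_left]
  intro x hx hx'
  obtain ⟨t, ⟨ht0, ht1⟩, rfl⟩ := mem_openSegment_iff_exists.1 hx
  obtain ⟨s, ⟨hs0, hs1⟩, hs⟩ := mem_openSegment_iff_exists.1 hx'
  have e1 := congrArg Prod.fst hs
  have e2 := congrArg Prod.snd hs
  simp only [Prod.fst_add, Prod.snd_add, Prod.smul_fst, Prod.smul_snd, Prod.fst_sub,
    Prod.snd_sub, smul_eq_mul] at e1 e2
  generalize hA : α * a.1 + β * a.2 = A at *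
  generalize hB : α * b.1 + β * b.2 = B at *
  generalize hP : α * p.1 + β * p.2 = P at *
  generalize hQ : α * q.1 + β * q.2 = Q at *
  have key : (1 - t) * (1 - s) * (P - A) + (1 - t) * s * (Q - A) + t * (1 - s) * (P - B) +
      t * s * (Q - B) = 0 := by
    subst hA hB hP hQ
    linear_combination α * e1 + β * e2
  have ht1' := sub_pos.2 ht1
  have hs1' := sub_pos.2 hs1
  have k1 := mul_nonneg (mul_pos ht1' hs1').le (sub_nonneg.2 h1)
  have k2 := mul_nonneg (mul_pos ht1' hs0).le (sub_nonneg.2 h2)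
  have k3 := mul_nonneg (mul_pos ht0 hs1').le (sub_nonneg.2 h3)
  have k4 := mul_nonneg (mul_pos ht0 hs0).le (sub_nonneg.2 h4)
  rcases h with h | h | h | h
  · linarith [mul_pos (mul_pos ht1' hs1') (sub_pos.2 h)]
  · linarith [mul_pos (mul_pos ht1' hs0) (sub_pos.2 h)]
  · linarith [mul_pos (mul_pos ht0 hs1') (sub_pos.2 h)]
  · linarith [mul_pos (mul_pos ht0 hs0) (sub_pos.2 h)]

/-- The real point with integral coordinates `a`. -/
def toPlane (a : ℤ × ℤ) : Plane := (a.1, a.2)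

lemma disjoint_of_sepBy {l a b p q : ℤ × ℤ} (h : SepBy l a b p q) :
    Disjoint (openSegment ℝ (toPlane a) (toPlane b)) (openSegment ℝ (toPlane p) (toPlane q)) := by
  unfold SepBy dotInt at h
  apply disjoint_openSegment_of_functional l.1 l.2 <;> simp only [toPlane]
  · exact_mod_cast h.1
  · exact_mod_cast h.2.1
  · exact_mod_cast h.2.2.1
  · exact_mod_cast h.2.2.2.1
  · exact_mod_cast h.2.2.2.2

lemma disjoint_of_separated {a b p q : ℤ × ℤ} (h : Separated a b p q) :
    Disjoint (openSegment ℝ (toPlane a) (toPlane b)) (openSegment ℝ (toPlane p) (toPlane q)) := by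
  obtain ⟨l, -, h | h⟩ := h <;> exact disjoint_of_sepBy h

lemma disjoint_frame {c : ℝ} (hc : 0 < c) (k : ℕ) {a b p q : Plane}
    (h : Disjoint (openSegment ℝ a b) (openSegment ℝ p q)) :
    Disjoint (openSegment ℝ (frame c k a) (frame c k b))
      (openSegment ℝ (frame c k p) (frame c k q)) := by
  rw [Set.disjoint_left] at h ⊢
  intro x hx hx'
  obtain ⟨r, hr, rfl⟩ := mem_openSegment_frame hx
  obtain ⟨r', hr', e⟩ := mem_openSegment_frame hx'
  rw [frame_injective hc k e] at hr
  exact h hr hr'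

/-! ### The layout -/

/-- The vertex that plays the role of `a` in the inner (`false`) or outer (`true`) end piece. -/
def endLabel (n : ℕ) (o : Bool) (a : Fin 9) : ℕ := if o then n - 1 - a else a

lemma endLabel_injective {n : ℕ} (hn : 18 ≤ n) {o o' : Bool} {a a' : Fin 9}
    (h : endLabel n o a = endLabel n o' a') : o = o' ∧ a = a' := by
  have := a.2
  have := a'.2
  cases o <;> cases o' <;> simp [endLabel, Fin.ext_iff] at h ⊢ <;> omega

/-- The distance of the vertex `i` from the origin, in the gauge. It is constant on the corners
of either end piece. -/
def radius (n i : ℕ) : ℝ := (max 8 (min i (n - 9)) : ℕ)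

lemma radius_lt {n i j : ℕ} (hn : 18 ≤ n) (hi : 6 ≤ i) (hij : i < j) (hmod : i % 3 = j % 3)
    (hj : j + 7 ≤ n) :
    radius n i < radius n j := by
  unfold radius
  have : max 8 (min i (n - 9)) < max 8 (min j (n - 9)) := by omega
  exact_mod_cast this

lemma radius_pos (n i : ℕ) : 0 < radius n i := by
  unfold radius
  exact_mod_cast (by omega : 0 < max 8 (min i (n - 9)))

/-- The position of the vertex `i`: up to a linear map, vertices of the end pieces are placed
according to `endPos`; the other ones lie on the three rays, cyclically. -/
noncomputable def vertexPos (n i : ℕ) : Plane :=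
  if h : i < 9 then frame (radius n 8 / 3) 0 (toPlane (endPos false ⟨i, h⟩))
  else if h : n - 1 - i < 9 then
    frame (radius n (n - 9) / 3) n (toPlane (endPos true ⟨n - 1 - i, h⟩))
  else radius n i • ray i

/-- The scale of an end piece. -/
noncomputable def endScale (n : ℕ) (o : Bool) : ℝ := radius n (if o then n - 9 else 8) / 3

lemma endScale_pos (n : ℕ) (o : Bool) : 0 < endScale n o :=
  div_pos (radius_pos _ _) three_pos

lemma vertexPos_endLabel {n : ℕ} (hn : 18 ≤ n) (o : Bool) (a : Fin 9) :
    vertexPos n (endLabel n o a) =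
      frame (endScale n o) (if o then n else 0) (toPlane (endPos o a)) := by
  have ha := a.2
  cases o
  · simp [vertexPos, endLabel, endScale]
  · have h1 : ¬ n - 1 - (a : ℕ) < 9 := by omega
    have h2 : n - 1 - (n - 1 - (a : ℕ)) = a := by omega
    simp [vertexPos, endLabel, endScale, h1, h2]

/-- The corners of the end pieces fit into the pattern of the vertices on the rays. -/
lemma vertexPos_eq_ray {n i : ℕ} (hn : 18 ≤ n) (hi : 6 ≤ i) (hi' : i + 7 ≤ n) :
    vertexPos n i = radius n i • ray i := by
  by_cases h : i < 9
  · have hr : radius n i = radius n 8 := by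
      unfold radius; congr 1; omega
    have : i = 6 ∨ i = 7 ∨ i = 8 := by omega
    rw [hr]
    rcases this with rfl | rfl | rfl <;>
      ext <;> simp [vertexPos, frame, toPlane, endPos, ray]
  by_cases h' : n - 1 - i < 9
  · have hr : radius n i = radius n (n - 9) := by
      unfold radius; congr 1; omega
    have hi3 : i = n - 9 ∨ i = n - 8 ∨ i = n - 7 := by omega
    rw [hr]
    rcases hi3 with e | e | e
    · have e1 : (⟨n - 1 - i, h'⟩ : Fin 9) = 8 := by ext; simp; omega
      rw [vertexPos, dif_neg h, dif_pos h', e1, ray_congr (by omega : i % 3 = n % 3)]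
      ext <;> simp [frame, toPlane, endPos] <;> ring
    · have e1 : (⟨n - 1 - i, h'⟩ : Fin 9) = 7 := by ext; simp; omega
      rw [vertexPos, dif_neg h, dif_pos h', e1, ray_congr (by omega : i % 3 = (n + 1) % 3)]
      ext <;> simp [frame, toPlane, endPos] <;> ring
    · have e1 : (⟨n - 1 - i, h'⟩ : Fin 9) = 6 := by ext; simp; omega
      rw [vertexPos, dif_neg h, dif_pos h', e1, ray_congr (by omega : i % 3 = (n + 2) % 3)]
      rcases mod_three_cases n with ⟨f, f'⟩ | ⟨f, f'⟩ | ⟨f, f'⟩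
      · have f'' : (n + 2) % 3 = 2 := by omega
        ext <;> simp [frame, toPlane, endPos, ray, f, f', f'']
      · have f'' : (n + 2) % 3 = 0 := by omega
        ext <;> simp [frame, toPlane, endPos, ray, f, f', f'']
      · have f'' : (n + 2) % 3 = 1 := by omega
        ext <;> simp [frame, toPlane, endPos, ray, f, f', f'']
  · rw [vertexPos, dif_neg h, dif_neg h']

/-- The vertices (`i = j`) and the possible edges that do not belong to an end piece. -/
def MidCell (n i j : ℕ) : Prop := i ≤ j ∧ j ≤ i + 3 ∧ 9 ≤ j ∧ i + 10 ≤ n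

/-- The vertices (`i = j`) and the possible edges of the drawing. -/
def Cell (n i j : ℕ) : Prop :=
  (∃ o, ∃ e ∈ endCells, i = endLabel n o e.1 ∧ j = endLabel n o e.2) ∨ MidCell n i j

/-- The points of the plane that represent a vertex or the interior of an edge. -/
def cellSet (n i j : ℕ) : Set Plane := openSegment ℝ (vertexPos n i) (vertexPos n j)

/-- A cell outside the end pieces runs along a ray or through the cone between two rays. -/
lemma midCell_cases {n i j : ℕ} (hn : 18 ≤ n) (h : MidCell n i j) {p : Plane}
    (hp : p ∈ cellSet n i j) :
    (∃ x, p = x • ray i + (0 : ℝ) • ray (i + 1) ∧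
      (j = i ∧ x = radius n i ∨ j = i + 3 ∧ radius n i < x ∧ x < radius n j)) ∨
    (∃ a b, ∃ w ∈ Set.Ioo (0 : ℝ) 1,
      p = (w * radius n a) • ray a + ((1 - w) * radius n b) • ray (a + 1) ∧
      (i = a ∧ j = b ∧ b = a + 1 ∨ i = b ∧ j = a ∧ a = b + 2)) := by
  obtain ⟨h1, h2, h3, h4⟩ := h
  rw [cellSet, vertexPos_eq_ray hn (by omega) (by omega),
    vertexPos_eq_ray hn (by omega) (by omega)] at hp
  obtain ⟨t, ⟨ht0, ht1⟩, rfl⟩ := mem_openSegment_iff_exists.1 hp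
  have : j = i ∨ j = i + 1 ∨ j = i + 2 ∨ j = i + 3 := by omega
  rcases this with rfl | rfl | rfl | rfl
  · left
    exact ⟨radius n j, by module, Or.inl ⟨rfl, rfl⟩⟩
  · right
    exact ⟨i, i + 1, 1 - t, ⟨by linarith, by linarith⟩, by module, Or.inl ⟨rfl, rfl, rfl⟩⟩
  · right
    refine ⟨i + 2, i, t, ⟨ht0, ht1⟩, ?_, Or.inr ⟨rfl, rfl, rfl⟩⟩
    rw [ray_congr (by omega : (i + 2 + 1) % 3 = i % 3)]
    module
  · left
    have hr : radius n i < radius n (i + 3) :=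
      radius_lt hn (by omega) (by omega) (by omega) (by omega)
    refine ⟨radius n i + t * (radius n (i + 3) - radius n i), ?_, Or.inr ⟨rfl, ?_, ?_⟩⟩
    · rw [ray_congr (by omega : (i + 3) % 3 = i % 3)]
      module
    · nlinarith
    · nlinarith

lemma disjoint_midCell {n i j i' j' : ℕ} (hn : 18 ≤ n) (h : MidCell n i j)
    (h' : MidCell n i' j') (hne : (i, j) ≠ (i', j')) :
    Disjoint (cellSet n i j) (cellSet n i' j') := by
  rw [Set.disjoint_left]
  intro p hp hp'
  have hpos := radius_pos n
  have hm := h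
  have hm' := h'
  obtain ⟨h1, h2, h3, h4⟩ := hm
  obtain ⟨h1', h2', h3', h4'⟩ := hm'
  have hne' : ¬ (i = i' ∧ j = j') := fun e => hne (Prod.ext e.1 e.2)
  rcases midCell_cases hn h hp with ⟨x, rfl, hx⟩ | ⟨a, b, w, ⟨hw0, hw1⟩, rfl, hab⟩ <;>
  rcases midCell_cases hn h' hp' with ⟨x', e, hx'⟩ | ⟨a', b', w', ⟨hw0', hw1'⟩, e, hab'⟩
  · -- Both cells lie on a ray.
    have hx0 : 0 < x := by rcases hx with ⟨-, rfl⟩ | ⟨-, hx, -⟩ <;> linarith [hpos i]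
    have hx0' : 0 < x' := by rcases hx' with ⟨-, rfl⟩ | ⟨-, hx, -⟩ <;> linarith [hpos i']
    obtain ⟨hmod, rfl, -⟩ := cone_unique hx0 le_rfl hx0' le_rfl e
    -- Of two cells on a ray, one ends before the other one begins.
    have key : ∀ {i j i' j' : ℕ}, MidCell n i j → MidCell n i' j' → i % 3 = i' % 3 → i < i' →
        (j = i ∧ x = radius n i ∨ j = i + 3 ∧ radius n i < x ∧ x < radius n j) →
        radius n i' ≤ x → False := by
      rintro i j i' j' ⟨g1, g2, g3, g4⟩ ⟨g1', g2', g3', g4'⟩ hmod hlt hx hx'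
      have hii := radius_lt (i := i) (j := i') hn (by omega) hlt hmod (by omega)
      rcases hx with ⟨-, hx⟩ | ⟨rfl, -, hx⟩
      · linarith
      · rcases (by omega : i' = i + 3 ∨ i + 3 < i') with rfl | hlt'
        · linarith
        · have := radius_lt (i := i + 3) (j := i') hn (by omega) hlt' (by omega) (by omega)
          linarith
    rcases lt_trichotomy i i' with hlt | rfl | hlt
    · exact key h h' hmod hlt hx (by rcases hx' with ⟨-, hx⟩ | ⟨-, hx, -⟩ <;> linarith)
    · rcases hx with ⟨e1, e2⟩ | ⟨e1, e2, -⟩ <;> rcases hx' with ⟨f1, f2⟩ | ⟨f1, f2, -⟩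
      · omega
      · linarith
      · linarith
      · omega
    · exact key h' h hmod.symm hlt hx' (by rcases hx with ⟨-, hx⟩ | ⟨-, hx, -⟩ <;> linarith)
  · have hx0 : 0 < x := by rcases hx with ⟨-, rfl⟩ | ⟨-, hx, -⟩ <;> linarith [hpos i]
    have hy := mul_pos (sub_pos.2 hw1') (hpos b')
    obtain ⟨-, -, hy'⟩ := cone_unique hx0 le_rfl (mul_pos hw0' (hpos a')) hy.le e
    linarith
  · have hx0 : 0 < x' := by rcases hx' with ⟨-, rfl⟩ | ⟨-, hx, -⟩ <;> linarith [hpos i']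
    have hy := mul_pos (sub_pos.2 hw1) (hpos b)
    obtain ⟨-, -, hy'⟩ := cone_unique (mul_pos hw0 (hpos a)) hy.le hx0 le_rfl e
    linarith
  · -- Both cells join the same two rays; they are ordered by the distances of their ends.
    obtain ⟨hmod, ex, ey⟩ := cone_unique (mul_pos hw0 (hpos a))
      (mul_pos (sub_pos.2 hw1) (hpos b)).le (mul_pos hw0' (hpos a'))
      (mul_pos (sub_pos.2 hw1') (hpos b')).le e
    have key : ∀ {a b a' b' : ℕ} {w w' : ℝ}, 0 < w → w < 1 → 0 < w' → w' < 1 →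
        a % 3 = a' % 3 → b % 3 = b' % 3 → 6 ≤ a → a' + 7 ≤ n → 6 ≤ b → b' + 7 ≤ n →
        a ≤ a' → b ≤ b' → ¬ (a = a' ∧ b = b') → w * radius n a = w' * radius n a' →
        (1 - w) * radius n b = (1 - w') * radius n b' → False := by
      intro a b a' b' w w' hw0 hw1 hw0' hw1' hma hmb ha ha' hb hb' hle hle' hne ex ey
      have ra : radius n a ≤ radius n a' := by
        rcases hle.eq_or_lt with rfl | hlt
        · exact le_rfl
        · exact (radius_lt hn ha hlt hma ha').le
      have rb : radius n b ≤ radius n b' := by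
        rcases hle'.eq_or_lt with rfl | hlt
        · exact le_rfl
        · exact (radius_lt hn hb hlt hmb hb').le
      have pa := hpos a
      have pb := hpos b
      have w1 : w' ≤ w := by
        by_contra! hc
        nlinarith
      have w2 : 1 - w' ≤ 1 - w := by
        by_contra! hc
        nlinarith
      have hww : w = w' := by linarith
      subst hww
      have ea := mul_left_cancel₀ hw0.ne' ex
      have eb := mul_left_cancel₀ (sub_pos.2 hw1).ne' ey
      rcases hle.eq_or_lt with e1 | hlt
      · rcases hle'.eq_or_lt with e2 | hlt'
        · exact hne ⟨e1, e2⟩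
        · exact (radius_lt hn hb hlt' hmb hb').ne eb
      · exact (radius_lt hn ha hlt hma ha').ne ea
    rcases (by omega : (a ≤ a' ∧ b ≤ b') ∨ (a' ≤ a ∧ b' ≤ b)) with ⟨g, g'⟩ | ⟨g, g'⟩
    · exact key hw0 hw1 hw0' hw1' hmod (by omega) (by omega) (by omega) (by omega) (by omega) g g'
        (by omega) ex ey
    · exact key hw0' hw1' hw0 hw1 hmod.symm (by omega) (by omega) (by omega) (by omega) (by omega)
        g g' (by omega) ex.symm ey.symm

lemma gauge₃_midCell {n i j : ℕ} (hn : 18 ≤ n) (h : MidCell n i j) {p : Plane}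
    (hp : p ∈ cellSet n i j) : radius n 8 < gauge₃ p ∧ gauge₃ p < radius n (n - 9) := by
  have hi : radius n 8 ≤ radius n i ∧ radius n i < radius n (n - 9) := by
    obtain ⟨h1, h2, h3, h4⟩ := h
    unfold radius
    exact_mod_cast (by omega)
  have hj : radius n 8 < radius n j ∧ radius n j ≤ radius n (n - 9) := by
    obtain ⟨h1, h2, h3, h4⟩ := h
    unfold radius
    exact_mod_cast (by omega)
  rcases midCell_cases hn h hp with ⟨x, rfl, hx⟩ | ⟨a, b, w, ⟨hw0, hw1⟩, rfl, hab⟩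
  · have hx0 : 0 < x := by rcases hx with ⟨-, rfl⟩ | ⟨-, hx, -⟩ <;> linarith [radius_pos n i]
    rw [gauge₃_cone hx0.le le_rfl]
    rcases hx with ⟨rfl, rfl⟩ | ⟨-, hx, hx'⟩ <;> constructor <;> linarith
  · rw [gauge₃_cone (mul_pos hw0 (radius_pos _ _)).le
      (mul_pos (sub_pos.2 hw1) (radius_pos _ _)).le]
    rcases hab with ⟨rfl, rfl, -⟩ | ⟨rfl, rfl, -⟩ <;> constructor <;> nlinarith

lemma gauge₃_inner {n : ℕ} (hn : 18 ≤ n) (a b : Fin 9) {p : Plane}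
    (hp : p ∈ cellSet n (endLabel n false a) (endLabel n false b)) : gauge₃ p ≤ radius n 8 := by
  rw [cellSet, vertexPos_endLabel hn, vertexPos_endLabel hn] at hp
  obtain ⟨r, hr, rfl⟩ := mem_openSegment_frame hp
  obtain ⟨t, ⟨ht0, ht1⟩, rfl⟩ := mem_openSegment_iff_exists.1 hr
  rw [gauge₃_frame (endScale_pos _ _).le]
  have hle : gauge₃ (toPlane (endPos false a) + t • (toPlane (endPos false b) -
      toPlane (endPos false a))) ≤ 3 := by
    obtain ⟨a1, a2, a3⟩ := endPos_inner_le a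
    obtain ⟨b1, b2, b3⟩ := endPos_inner_le b
    generalize endPos false a = u at *
    generalize endPos false b = v at *
    have a1' : (u.1 : ℝ) + u.2 ≤ 3 := by exact_mod_cast a1
    have a2' : (u.2 : ℝ) - 2 * u.1 ≤ 3 := by exact_mod_cast a2
    have a3' : (u.1 : ℝ) - 2 * u.2 ≤ 3 := by exact_mod_cast a3
    have b1' : (v.1 : ℝ) + v.2 ≤ 3 := by exact_mod_cast b1
    have b2' : (v.2 : ℝ) - 2 * v.1 ≤ 3 := by exact_mod_cast b2
    have b3' : (v.1 : ℝ) - 2 * v.2 ≤ 3 := by exact_mod_cast b3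
    simp only [gauge₃, toPlane, Prod.fst_add, Prod.snd_add, Prod.smul_fst, Prod.smul_snd,
      Prod.fst_sub, Prod.snd_sub, smul_eq_mul]
    refine max_le ?_ (max_le ?_ ?_)
    · nlinarith
    · nlinarith
    · nlinarith
  calc endScale n false * _ ≤ endScale n false * 3 :=
        mul_le_mul_of_nonneg_left hle (endScale_pos _ _).le
    _ = radius n 8 := by simp [endScale]

lemma le_gauge₃_outer {n : ℕ} (hn : 18 ≤ n) {e : Fin 9 × Fin 9} (he : e ∈ endCells) {p : Plane}
    (hp : p ∈ cellSet n (endLabel n true e.1) (endLabel n true e.2)) :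
    radius n (n - 9) ≤ gauge₃ p := by
  rw [cellSet, vertexPos_endLabel hn, vertexPos_endLabel hn] at hp
  obtain ⟨r, hr, rfl⟩ := mem_openSegment_frame hp
  obtain ⟨t, ⟨ht0, ht1⟩, rfl⟩ := mem_openSegment_iff_exists.1 hr
  rw [gauge₃_frame (endScale_pos _ _).le]
  have hle : 3 ≤ gauge₃ (toPlane (endPos true e.1) + t • (toPlane (endPos true e.2) -
      toPlane (endPos true e.1))) := by
    have h := le_endPos_outer e he
    generalize endPos true e.1 = u at *
    generalize endPos true e.2 = v at *
    simp only [gauge₃, toPlane, Prod.fst_add, Prod.snd_add, Prod.smul_fst, Prod.smul_snd,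
      Prod.fst_sub, Prod.snd_sub, smul_eq_mul, le_max_iff]
    rcases h with ⟨h, h'⟩ | ⟨h, h'⟩ | ⟨h, h'⟩
    · left
      have k : (3 : ℝ) ≤ u.1 + u.2 := by exact_mod_cast h
      have k' : (3 : ℝ) ≤ v.1 + v.2 := by exact_mod_cast h'
      nlinarith
    · right; left
      have k : (3 : ℝ) ≤ u.2 - 2 * u.1 := by exact_mod_cast h
      have k' : (3 : ℝ) ≤ v.2 - 2 * v.1 := by exact_mod_cast h'
      nlinarith
    · right; right
      have k : (3 : ℝ) ≤ u.1 - 2 * u.2 := by exact_mod_cast h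
      have k' : (3 : ℝ) ≤ v.1 - 2 * v.2 := by exact_mod_cast h'
      nlinarith
  calc radius n (n - 9) = endScale n true * 3 := by simp [endScale]
    _ ≤ _ := mul_le_mul_of_nonneg_left hle (endScale_pos _ _).le

/-- The ten crossings of the drawing. -/
def crossingPair (n : ℕ) (k : Bool × Fin 5) : Sym2 (Sym2 ℕ) :=
  (endCrossing k.2).map (Sym2.map (endLabel n k.1))

lemma crossingPair_eq_of_mem {n : ℕ} (hn : 18 ≤ n) {k k' : Bool × Fin 5} {e : Sym2 ℕ}
    (h : e ∈ crossingPair n k) (h' : e ∈ crossingPair n k') : k = k' := by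
  obtain ⟨o, k⟩ := k
  obtain ⟨o', k'⟩ := k'
  obtain ⟨f, hf, rfl⟩ := Sym2.mem_map.1 h
  obtain ⟨f', hf', e⟩ := Sym2.mem_map.1 h'
  have ho : o = o' := by
    induction f with | _ a b
    induction f' with | _ a' b'
    rcases Sym2.eq_iff.1 e with ⟨e, -⟩ | ⟨e, -⟩ <;> exact (endLabel_injective hn e).1.symm
  subst ho
  obtain rfl := Sym2.map.injective (fun a a' h => (endLabel_injective hn h).2) e
  induction f' with | _ a b
  rw [endCrossing_eq_of_mem k k' a b hf hf']

/-- Two distinct cells are disjoint, or they are one of the ten crossing pairs. -/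
theorem disjoint_cell {n i j i' j' : ℕ} (hn : 18 ≤ n) (h : Cell n i j) (h' : Cell n i' j')
    (hne : (i, j) ≠ (i', j')) : Disjoint (cellSet n i j) (cellSet n i' j') ∨
      (det₂ (vertexPos n j - vertexPos n i) (vertexPos n j' - vertexPos n i') ≠ 0 ∧
        ∃ k, s(s(i, j), s(i', j')) = crossingPair n k) := by
  have hr : radius n 8 < radius n (n - 9) := by
    unfold radius; exact_mod_cast (by omega)
  rcases h with ⟨o, e, he, rfl, rfl⟩ | h <;> rcases h' with ⟨o', e', he', rfl, rfl⟩ | h'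
  · by_cases ho : o = o'
    · subst ho
      have hee : e ≠ e' := fun hee => hne (by rw [hee])
      rcases separated_endCells o e he e' he' hee with hs | ⟨hd, k, hk⟩
      · left
        simp only [cellSet, vertexPos_endLabel hn]
        exact disjoint_frame (endScale_pos _ _) _ (disjoint_of_separated hs)
      · right
        refine ⟨?_, (o, k), ?_⟩
        · simp only [vertexPos_endLabel hn, frame_sub, det₂_frame]
          refine mul_ne_zero (pow_ne_zero _ (endScale_pos _ _).ne') ?_
          simp only [det₂, toPlane, Prod.fst_sub, Prod.snd_sub] at hd ⊢
          exact_mod_cast hd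
        · simp [crossingPair, ← hk]
    · left
      rw [Set.disjoint_left]
      intro p hp hp'
      cases o <;> cases o'
      · exact ho rfl
      · exact absurd (hr.trans_le (le_gauge₃_outer hn he' hp')) (gauge₃_inner hn _ _ hp).not_gt
      · exact absurd (hr.trans_le (le_gauge₃_outer hn he hp)) (gauge₃_inner hn _ _ hp').not_gt
      · exact ho rfl
  · left
    rw [Set.disjoint_left]
    intro p hp hp'
    obtain ⟨g1, g2⟩ := gauge₃_midCell hn h' hp'
    cases o
    · exact (gauge₃_inner hn _ _ hp).not_gt g1
    · exact (le_gauge₃_outer hn he hp).not_gt g2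
  · left
    rw [Set.disjoint_left]
    intro p hp hp'
    obtain ⟨g1, g2⟩ := gauge₃_midCell hn h hp
    cases o'
    · exact (gauge₃_inner hn _ _ hp').not_gt g1
    · exact (le_gauge₃_outer hn he' hp').not_gt g2
  · exact Or.inl (disjoint_midCell hn h h' hne)

/-! ### The three edge colours -/

/-- The length of the edge of colour `c` that leads upwards from the vertex `i`. -/
def colorStep (c : Fin 3) (i : ℕ) : ℕ :=
  if c = 0 then 2 else if c = 1 then (if i % 2 = 0 then 1 else 3) else (if i % 2 = 0 then 3 else 1)

lemma colorStep_injective {c c' : Fin 3} {i : ℕ} (h : colorStep c i = colorStep c' i) :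
    c = c' := by
  rcases Nat.mod_two_eq_zero_or_one i with hi | hi <;> revert h <;>
    fin_cases c <;> fin_cases c' <;> simp [colorStep, hi]

lemma colorStep_mem (c : Fin 3) (i : ℕ) : 1 ≤ colorStep c i ∧ colorStep c i ≤ 3 := by
  unfold colorStep; split_ifs <;> omega

/-- The colour that `c` stands for in an end piece. The outer end piece is the mirror image of the
inner one; for odd `n` the reflection exchanges the colours `1` and `2`. -/
def endColor (n : ℕ) (o : Bool) (c : Fin 3) : Fin 3 :=
  if o = true ∧ n % 2 = 1 then Equiv.swap 1 2 c else c

lemma endColor_injective (n : ℕ) (o : Bool) : Function.Injective (endColor n o) := by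
  unfold endColor
  split_ifs
  · exact (Equiv.swap 1 2).injective
  · exact Function.injective_id

lemma endColor_eq_two (n : ℕ) (c : Fin 3) :
    endColor n true c = 2 ↔ c = 1 ∧ n % 2 = 1 ∨ c = 2 ∧ n % 2 = 0 := by
  rcases Nat.mod_two_eq_zero_or_one n with h | h <;> fin_cases c <;>
    (simp [endColor, h]; try decide)

/-- The edges of colour `c`, each with one of its two orientations. -/
def ColorEdge (n : ℕ) (c : Fin 3) (i j : ℕ) : Prop :=
  (∃ o, ∃ e ∈ endEdges (endColor n o c), i = endLabel n o e.1 ∧ j = endLabel n o e.2) ∨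
    (9 ≤ j ∧ i + 10 ≤ n ∧ j = i + colorStep c i)

/-- Adjacency by an edge of colour `c`. -/
def ColorAdj (n : ℕ) (c : Fin 3) (i j : ℕ) : Prop := ColorEdge n c i j ∨ ColorEdge n c j i

lemma ColorEdge.cell {n : ℕ} {c : Fin 3} {i j : ℕ} (h : ColorEdge n c i j) : Cell n i j := by
  rcases h with ⟨o, e, he, h⟩ | ⟨h1, h2, h3⟩
  · exact Or.inl ⟨o, e, endEdges_subset_endCells he, h⟩
  · have := colorStep_mem c i
    exact Or.inr ⟨by omega, by omega, h1, h2⟩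

lemma endEdges_ne : ∀ c : Fin 3, ∀ e ∈ endEdges c, e.1 ≠ e.2 := by
  decide +kernel

lemma ColorEdge.ne {n : ℕ} (hn : 18 ≤ n) {c : Fin 3} {i j : ℕ} (h : ColorEdge n c i j) :
    i ≠ j := by
  rcases h with ⟨o, e, he, rfl, rfl⟩ | ⟨h1, h2, h3⟩
  · exact fun h => endEdges_ne _ _ he (endLabel_injective hn h).2
  · have := colorStep_mem c i
    omega

/-- Edges between vertices of an end piece are not edges of the middle part. -/
lemma endLabel_not_mid {n : ℕ} (o : Bool) (a b : Fin 9) :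
    ¬ (9 ≤ endLabel n o b ∧ endLabel n o a + 10 ≤ n) := by
  have := a.2
  have := b.2
  cases o <;> simp only [endLabel, Bool.false_eq_true, if_true, if_false] <;> omega

lemma ColorAdj.color_unique {n : ℕ} (hn : 18 ≤ n) {c c' : Fin 3} {i j : ℕ}
    (h : ColorAdj n c i j) (h' : ColorAdj n c' i j) : c = c' := by
  have key : ∀ {i j i' j' : ℕ}, s(i, j) = s(i', j') → ColorEdge n c i j → ColorEdge n c' i' j' →
      c = c' := by
    rintro i j i' j' hs (⟨o, e, he, rfl, rfl⟩ | ⟨h1, h2, h3⟩)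
      (⟨o', e', he', rfl, rfl⟩ | ⟨h1', h2', h3'⟩)
    · have ho : o = o' := by
        rcases Sym2.eq_iff.1 hs with ⟨h, -⟩ | ⟨h, -⟩ <;> exact (endLabel_injective hn h).1
      subst ho
      have hs' : s(e.1, e.2) = s(e'.1, e'.2) :=
        Sym2.map.injective (f := endLabel n o) (fun a a' h => (endLabel_injective hn h).2) hs
      exact endColor_injective n o (endEdges_color_unique _ _ e he e' he' hs')
    · rcases Sym2.eq_iff.1 hs with ⟨rfl, rfl⟩ | ⟨rfl, rfl⟩
      · exact absurd ⟨h1', h2'⟩ (endLabel_not_mid o _ _)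
      · exact absurd ⟨h1', h2'⟩ (endLabel_not_mid o _ _)
    · rcases Sym2.eq_iff.1 hs with ⟨rfl, rfl⟩ | ⟨rfl, rfl⟩
      · exact absurd ⟨h1, h2⟩ (endLabel_not_mid o' _ _)
      · exact absurd ⟨h1, h2⟩ (endLabel_not_mid o' _ _)
    · have := colorStep_mem c i
      have := colorStep_mem c' i'
      rcases Sym2.eq_iff.1 hs with ⟨rfl, rfl⟩ | ⟨rfl, rfl⟩
      · exact colorStep_injective (i := i) (by omega)
      · omega
  rcases h with h | h <;> rcases h' with h' | h'
  · exact key rfl h h'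
  · exact key Sym2.eq_swap h h'
  · exact key Sym2.eq_swap h h'
  · exact key rfl h h'

/-- The graph formed by the edges of colour `c`. -/
def colorGraph (n : ℕ) (hn : 18 ≤ n) (c : Fin 3) : SimpleGraph (Fin n) where
  Adj u v := ColorAdj n c u v
  symm := ⟨fun _ _ h => h.symm⟩
  loopless := ⟨fun _ h => h.elim (fun h => h.ne hn rfl) (fun h => h.ne hn rfl)⟩

lemma disjoint_colorGraph {n : ℕ} (hn : 18 ≤ n) {c c' : Fin 3} (h : c ≠ c') :
    Disjoint (colorGraph n hn c) (colorGraph n hn c') := by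
  rw [disjoint_iff_inf_le]
  exact fun u v huv => h (ColorAdj.color_unique hn huv.1 huv.2)

/-! ### Each colour class is a Hamiltonian cycle -/

/-- The last vertex of the Hamiltonian path of colour `c` on the vertices below `k`; the first one
is `k - 1`. -/
def pathEnd (c : Fin 3) (k : ℕ) : ℕ :=
  if c = 0 then k - 2 else if c = 1 then (if k % 2 = 0 then k - 3 else k - 2)
  else (if k % 2 = 0 then k - 2 else k - 3)

lemma endEdges_mem_of_endPath (c : Fin 3) :
    (endPath c).IsChain (fun a b => (a, b) ∈ endEdges c) := by
  revert c; decide +kernel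

lemma endPath_mem : ∀ (c : Fin 3) (a : Fin 9), a ∈ endPath c := by
  decide +kernel

lemma endPath_nodup : ∀ c : Fin 3, (endPath c).Nodup := by
  decide +kernel

lemma isChain_map_endPath (n : ℕ) (o : Bool) (c : Fin 3) :
    ((endPath (endColor n o c)).map (endLabel n o)).IsChain (ColorAdj n c) := by
  rw [List.isChain_map]
  exact (endEdges_mem_of_endPath _).imp fun a b h => Or.inl (Or.inl ⟨o, (a, b), h, rfl, rfl⟩)

/-- In each colour, the vertices below `k` are joined by a path with ends `k - 1` and
`pathEnd c k`: the vertex `k` is attached to one of the ends, and replaces it. -/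
lemma exists_path {n : ℕ} (hn : 18 ≤ n) (c : Fin 3) (k : ℕ) (hk : 9 ≤ k) (hkn : k + 9 ≤ n) :
    ∃ l : List ℕ, l.Nodup ∧ (∀ i, i ∈ l ↔ i < k) ∧ l.IsChain (ColorAdj n c) ∧
      l.head? = some (k - 1) ∧ l.getLast? = some (pathEnd c k) := by
  induction k, hk using Nat.le_induction with
  | base =>
    refine ⟨(endPath c).map (endLabel n false), ?_, ?_, ?_, ?_, ?_⟩
    · exact (endPath_nodup c).map fun a b h => (endLabel_injective hn h).2
    · intro i
      rw [List.mem_map]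
      constructor
      · rintro ⟨a, -, rfl⟩
        exact a.2
      · exact fun hi => ⟨⟨i, hi⟩, endPath_mem _ _, rfl⟩
    · exact isChain_map_endPath n false c
    · fin_cases c <;> rfl
    · fin_cases c <;> rfl
  | succ k hk ih =>
    obtain ⟨l, hnd, hmem, hch, hhead, hlast⟩ := ih (by omega)
    have hkl : k ∉ l := fun h => (hmem k).1 h |>.false
    by_cases hcase : c = 0 ∨ pathEnd c k = k - 3
    · -- The path is continued at its last vertex, and then reversed.
      refine ⟨(l ++ [k]).reverse, ?_, ?_, ?_, ?_, ?_⟩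
      · rw [List.nodup_reverse, List.nodup_append]
        refine ⟨hnd, List.nodup_singleton k, fun a ha b hb => ?_⟩
        rw [List.mem_singleton] at hb
        rintro rfl
        exact hkl (hb ▸ ha)
      · intro i
        simp only [List.mem_reverse, List.mem_append, hmem, List.mem_singleton]
        omega
      · rw [List.isChain_reverse]
        have : (fun a b => ColorAdj n c b a) = ColorAdj n c := by
          funext a b; exact propext or_comm
        rw [this, List.isChain_append]
        refine ⟨hch, List.isChain_singleton k, ?_⟩
        intro x hx y hy
        rw [hlast, Option.mem_some_iff] at hx
        rw [List.head?_cons, Option.mem_some_iff] at hy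
        subst hx hy
        refine Or.inl (Or.inr ⟨hk, ?_, ?_⟩)
        · unfold pathEnd; split_ifs <;> omega
        · revert hcase; unfold pathEnd colorStep; fin_cases c <;> simp <;> (try split_ifs) <;> omega
      · simp
      · rw [List.getLast?_reverse, List.head?_append, hhead]
        revert hcase; unfold pathEnd; fin_cases c <;> simp <;> omega
    · refine ⟨k :: l, List.nodup_cons.2 ⟨hkl, hnd⟩, ?_, ?_, rfl, ?_⟩
      · intro i
        simp only [List.mem_cons, hmem]
        omega
      · rw [← List.singleton_append, List.isChain_append]
        refine ⟨List.isChain_singleton k, hch, ?_⟩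
        intro x hx y hy
        rw [hhead, Option.mem_some_iff] at hy
        rw [List.getLast?_singleton, Option.mem_some_iff] at hx
        subst hx hy
        refine Or.inr (Or.inr ⟨hk, by omega, ?_⟩)
        revert hcase; unfold pathEnd colorStep; fin_cases c <;> simp <;> (try split_ifs) <;> omega
      · rw [List.getLast?_cons, hlast]
        revert hcase; unfold pathEnd; fin_cases c <;> simp <;> (try split_ifs) <;> omega

/-- A list of all vertices in cyclic order, successive ones being adjacent in colour `c`. -/
lemma exists_cycle {n : ℕ} (hn : 18 ≤ n) (c : Fin 3) :
    ∃ l : List ℕ, l.Nodup ∧ (∀ i, i ∈ l ↔ i < n) ∧ l.IsChain (ColorAdj n c) ∧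
      ∀ x ∈ l.getLast?, ∀ y ∈ l.head?, ColorAdj n c x y := by
  obtain ⟨l, hnd, hmem, hch, hhead, hlast⟩ := exists_path hn c (n - 9) (by omega) (by omega)
  have hsymm : (fun a b => ColorAdj n c b a) = ColorAdj n c := by
    funext a b; exact propext or_comm
  set o := (endPath (endColor n true c)).map (endLabel n true) with ho
  have hond : o.Nodup := (endPath_nodup _).map fun a b h => (endLabel_injective hn h).2
  have homem : ∀ i, i ∈ o ↔ n - 9 ≤ i ∧ i < n := by
    intro i
    rw [ho, List.mem_map]
    constructor
    · rintro ⟨a, -, rfl⟩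
      have := a.2
      simp only [endLabel, if_true]
      omega
    · rintro ⟨h1, h2⟩
      refine ⟨⟨n - 1 - i, by omega⟩, endPath_mem _ _, ?_⟩
      simp only [endLabel, if_true]
      omega
  have hoch : o.IsChain (ColorAdj n c) := isChain_map_endPath n true c
  have hohead : o.head? = some (n - 9) := by
    have : ∀ c, (endPath c).head? = some 8 := by decide +kernel
    rw [ho, List.head?_map, this, Option.map_some]
    simp [endLabel]
    omega
  have holast : o.getLast? = some (if endColor n true c = 2 then n - 7 else n - 8) := by
    have : ∀ c, (endPath c).getLast? = some (if c = 2 then 6 else 7) := by decide +kernel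
    rw [ho, List.getLast?_map, this, Option.map_some]
    split_ifs <;> simp [endLabel] <;> omega
  -- It remains to join the path on the other vertices to the path `o` at both ends.
  suffices h : ∃ o' : List ℕ, o'.Nodup ∧ (∀ i, i ∈ o' ↔ n - 9 ≤ i ∧ i < n) ∧
      o'.IsChain (ColorAdj n c) ∧ ∃ a b, o'.head? = some a ∧ o'.getLast? = some b ∧
      ColorEdge n c (pathEnd c (n - 9)) a ∧ ColorEdge n c (n - 9 - 1) b by
    obtain ⟨o', hnd', hmem', hch', a, b, ha, hb, h1, h2⟩ := h
    refine ⟨l ++ o', ?_, ?_, ?_, ?_⟩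
    · rw [List.nodup_append]
      refine ⟨hnd, hnd', fun x hx y hy hxy => ?_⟩
      rw [hmem] at hx
      rw [hmem'] at hy
      omega
    · intro i
      rw [List.mem_append, hmem, hmem']
      omega
    · rw [List.isChain_append]
      refine ⟨hch, hch', fun x hx y hy => ?_⟩
      rw [hlast, Option.mem_some_iff] at hx
      rw [ha, Option.mem_some_iff] at hy
      subst hx hy
      exact Or.inl h1
    · intro x hx y hy
      rw [List.getLast?_append, hb, Option.some_or, Option.mem_some_iff] at hx
      rw [List.head?_append, hhead, Option.some_or, Option.mem_some_iff] at hy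
      subst hx hy
      exact Or.inr h2
  by_cases hcase : c = 0 ∨ pathEnd c (n - 9) = n - 9 - 3
  · refine ⟨o, hond, homem, hoch, _, _, hohead, holast, Or.inr ⟨by omega, ?_, ?_⟩,
      Or.inr ⟨?_, by omega, ?_⟩⟩
    · unfold pathEnd; split_ifs <;> omega
    · revert hcase; unfold pathEnd colorStep; fin_cases c <;> simp <;> (try split_ifs) <;> omega
    · split_ifs <;> omega
    · rw [if_congr (endColor_eq_two n c) rfl rfl]
      revert hcase; unfold pathEnd colorStep
      fin_cases c <;> simp <;> (try split_ifs) <;> omega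
  · refine ⟨o.reverse, List.nodup_reverse.2 hond, fun i => by rw [List.mem_reverse, homem], ?_,
      _, _, by rw [List.head?_reverse, holast], by rw [List.getLast?_reverse, hohead],
      Or.inr ⟨?_, ?_, ?_⟩, Or.inr ⟨by omega, by omega, ?_⟩⟩
    · rw [List.isChain_reverse, hsymm]
      exact hoch
    · split_ifs <;> omega
    · unfold pathEnd; split_ifs <;> omega
    · rw [if_congr (endColor_eq_two n c) rfl rfl]
      revert hcase; unfold pathEnd colorStep
      fin_cases c <;> simp <;> (try split_ifs) <;> omega
    · revert hcase; unfold pathEnd colorStep; fin_cases c <;> simp <;> (try split_ifs) <;> omega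

/-- A cyclic list of all vertices gives a spanning copy of the cycle graph. -/
lemma exists_equiv_of_cyclic_list {n : ℕ} {R : ℕ → ℕ → Prop} {l : List ℕ} (hnd : l.Nodup)
    (hmem : ∀ i, i ∈ l ↔ i < n) (hch : l.IsChain R)
    (hclose : ∀ x ∈ l.getLast?, ∀ y ∈ l.head?, R x y) :
    ∃ e : Fin n ≃ Fin n, ∀ u v, (SimpleGraph.cycleGraph n).Adj u v →
      R (e u) (e v) ∨ R (e v) (e u) := by
  have hlen : l.length = n := by
    have : l.Perm (List.range n) :=
      (List.perm_ext_iff_of_nodup hnd List.nodup_range).2 fun i => by rw [hmem, List.mem_range]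
    rw [this.length_eq, List.length_range]
  subst hlen
  let f : Fin l.length → Fin l.length := fun i => ⟨l[i], (hmem _).1 (List.getElem_mem i.2)⟩
  have hf : Function.Injective f := fun i j h =>
    Fin.ext ((hnd.getElem_inj_iff).1 (congrArg Fin.val h))
  have hstep : ∀ u v : Fin l.length, (u - v).val = 1 → R (f v) (f u) := by
    intro u v h
    have hu := u.2
    have hv := v.2
    rw [Fin.sub_def] at h
    simp only at h
    have : (u : ℕ) = v + 1 ∨ ((u : ℕ) = 0 ∧ (v : ℕ) = l.length - 1) := by
      rcases le_or_gt (v : ℕ) u with hle | hlt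
      · rw [(by omega : l.length - v + u = l.length + (u - v : ℕ)), Nat.add_mod_left,
          Nat.mod_eq_of_lt (by omega)] at h
        omega
      · rw [Nat.mod_eq_of_lt (by omega)] at h
        omega
    rcases this with h | ⟨h0, h1⟩
    · have := List.isChain_iff_getElem.1 hch v (by omega)
      simpa [f, h] using this
    · apply hclose
      · simp [f, h1, List.getLast?_eq_getElem?]
      · simp [f, h0, List.head?_eq_getElem?]
  refine ⟨Equiv.ofBijective f (Finite.injective_iff_bijective.1 hf), fun u v h => ?_⟩
  rcases SimpleGraph.cycleGraph_adj'.1 h with h | h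
  · exact Or.inr (hstep u v h)
  · exact Or.inl (hstep v u h)

lemma isPacking_colorGraph {n : ℕ} (hn : 18 ≤ n) {W : Fin 3 → Type*}
    (C : ∀ i, SimpleGraph (W i)) (hC : ∀ i, Nonempty (C i ≃g SimpleGraph.cycleGraph n)) :
    IsPacking C (⨆ c, colorGraph n hn c) := by
  have h : ∀ i, ∃ φ : W i ≃ Fin n, (C i).map φ.toEmbedding ≤ colorGraph n hn i := by
    intro i
    obtain ⟨ψ⟩ := hC i
    obtain ⟨l, hnd, hmem, hch, hclose⟩ := exists_cycle hn i
    obtain ⟨e, he⟩ := exists_equiv_of_cyclic_list hnd hmem hch hclose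
    refine ⟨ψ.toEquiv.trans e, ?_⟩
    rw [SimpleGraph.map_le_iff_le_comap]
    intro u v huv
    exact (he _ _ (ψ.map_adj_iff.2 huv)).elim id Or.symm
  choose φ hφ using h
  refine ⟨φ, fun i => (hφ i).trans (le_iSup _ i), fun i j hij => ?_⟩
  rw [SimpleGraph.disjoint_edgeSet]
  exact (disjoint_colorGraph hn hij).mono (hφ i) (hφ j)

/-! ### The drawing -/

lemma cell_self {n : ℕ} (i : Fin n) : Cell n i i := by
  have hi := i.2
  by_cases h : (i : ℕ) < 9
  · exact Or.inl ⟨false, _, diag_mem_endCells ⟨i, h⟩, by simp [endLabel], by simp [endLabel]⟩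
  by_cases h' : n - 1 - i < 9
  · refine Or.inl ⟨true, _, diag_mem_endCells ⟨n - 1 - i, h'⟩, ?_, ?_⟩ <;>
      simp only [endLabel, if_true] <;> omega
  · exact Or.inr ⟨le_rfl, by omega, by omega, by omega⟩

/-- A vertex is disjoint from all other cells. -/
lemma vertexPos_notMem_cellSet {n : ℕ} (hn : 18 ≤ n) (w : Fin n) {i j : ℕ} (h : Cell n i j)
    (hne : ((w : ℕ), (w : ℕ)) ≠ (i, j)) : vertexPos n w ∉ cellSet n i j := by
  rcases disjoint_cell hn (cell_self w) h hne with hd | ⟨hd, -⟩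
  · refine Set.disjoint_left.1 hd ?_
    simp [cellSet]
  · simp [det₂] at hd

/-- Ten crossings suffice: five in each end piece. -/
theorem exists_planeDrawing {n : ℕ} (hn : 18 ≤ n) :
    ∃ D : PlaneDrawing (⨆ c, colorGraph n hn c), D.IsOnePlane ∧ D.crossings.encard ≤ 10 := by
  have hadj : ∀ {u v : Fin n}, (⨆ c, colorGraph n hn c).Adj u v →
      ∃ c, ColorEdge n c u v ∨ ColorEdge n c v u := fun h => SimpleGraph.iSup_adj.1 h
  have := exists_planeDrawing_of_segments (⨆ c, colorGraph n hn c) (fun u => vertexPos n u)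
    Fin.valEmbedding (crossingPair n) ?_ ?_ ?_ (fun k k' e => crossingPair_eq_of_mem hn)
  · simpa using this
  · intro u v huv
    by_contra hne
    refine vertexPos_notMem_cellSet hn u (cell_self v) (fun h => hne (Fin.ext ?_)) ?_
    · exact congrArg Prod.fst h
    · simpa [cellSet] using huv
  · intro u v w huv
    obtain ⟨c, h | h⟩ := hadj huv
    · refine vertexPos_notMem_cellSet hn w h.cell fun e => h.ne hn ?_
      exact (congrArg Prod.fst e).symm.trans (congrArg Prod.snd e)
    · rw [openSegment_symm]
      refine vertexPos_notMem_cellSet hn w h.cell fun e => h.ne hn ?_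
      exact (congrArg Prod.fst e).symm.trans (congrArg Prod.snd e)
  · intro u v u' v' h h' hne
    have hne' : s((u : ℕ), (v : ℕ)) ≠ s((u' : ℕ), (v' : ℕ)) := fun e =>
      hne (Sym2.map.injective Fin.val_injective e)
    have ne_of : ∀ {i j i' j' : ℕ}, s(i, j) ≠ s(i', j') → (i, j) ≠ (i', j') := fun h e =>
      h (congrArg (fun p : ℕ × ℕ => s(p.1, p.2)) e)
    obtain ⟨c, h | h⟩ := hadj h <;> obtain ⟨c', h' | h'⟩ := hadj h'
    · exact disjoint_cell hn h.cell h'.cell (ne_of hne')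
    · have := disjoint_cell hn h.cell h'.cell (ne_of (by rwa [Sym2.eq_swap (a := (v' : ℕ))]))
      rwa [cellSet, cellSet, openSegment_symm ℝ (vertexPos n v'), ← neg_sub (vertexPos n v'),
        det₂_neg_right, neg_ne_zero, Sym2.eq_swap (a := (v' : ℕ))] at this
    · have := disjoint_cell hn h.cell h'.cell (ne_of (by rwa [Sym2.eq_swap (a := (v : ℕ))]))
      rwa [cellSet, cellSet, openSegment_symm ℝ (vertexPos n v), ← neg_sub (vertexPos n v),
        det₂_neg_left, neg_ne_zero, Sym2.eq_swap (a := (v : ℕ))] at this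
    · have := disjoint_cell hn h.cell h'.cell
        (ne_of (by rwa [Sym2.eq_swap (a := (v : ℕ)), Sym2.eq_swap (a := (v' : ℕ))]))
      rwa [cellSet, cellSet, openSegment_symm ℝ (vertexPos n v),
        openSegment_symm ℝ (vertexPos n v'), ← neg_sub (vertexPos n v),
        ← neg_sub (vertexPos n v'), det₂_neg_left, det₂_neg_right, neg_neg,
        Sym2.eq_swap (a := (v : ℕ)), Sym2.eq_swap (a := (v' : ℕ))] at this

theorem theorem6 (n : ℕ) (hn : 20 ≤ n) {W : Fin 3 → Type*} (C : ∀ i, SimpleGraph (W i))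
    (hC : ∀ i, Nonempty (C i ≃g SimpleGraph.cycleGraph n)) :
    ∃ G : SimpleGraph (Fin n), IsPacking C G ∧
      ∃ D : PlaneDrawing G, D.IsOnePlane ∧ D.crossings.encard ≤ 14 := by
  have hn' : 18 ≤ n := by omega
  obtain ⟨D, hD, hcard⟩ := exists_planeDrawing hn'
  exact ⟨_, isPacking_colorGraph hn' C hC, D, hD, hcard.trans (by norm_num)⟩
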